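/- Let $n,m\ge 1$ be integers and let $\mathbf k=(k_1,\dots,k_n)$ be real numbers with $k_j>0$ for all $j$ and $\sum_{j=1}^n k_j=1$. For a real $n\times m$ matrix $\mathcal L=(x_{ji})$ and $\mathbf q\in\mathbb Z^m$ put $L_j(\mathbf q)=\sum_{i=1}^m q_i x_{ji}$ $(1\le j\le n)$; let $|\mathbf q|$ be the supremum norm and $\|x\|$ the distance from $x\in\mathbb R$ to the nearest integer. Suppose that $\mathcal L\in\mathrm{Bad}(\mathbf k,n,m)$, that is, $$\inf_{\mathbf q\in\mathbb Z^m\setminus\{\mathbf 0\}}\ \max_{1\le j\le n}\ |\mathbf q|^{mk_j}\,\|L_j(\mathbf q)\|>0 .$$ Then the set $$\mathrm{Bad}_{\mathcal L}(\mathbf k,n,m)=\Big\{\boldsymbol\alpha\in[0,1)^n:\ \inf_{\mathbf q\in\mathbb Z^m\setminus\{\mathbf 0\}}\ \max_{1\le j\le n}\ |\mathbf q|^{mk_j}\,\|L_j(\mathbf q)-\alpha_j\|>0\Big\}$$ is $1/2$-winning for Schmidt's game with the Euclidean metric, both when $[0,1)^n$ is identified with $\mathbb R^n/\mathbb Z^n$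 (the game is played on $\mathbb R^n$, with the $\mathbb Z^n$-periodic extension of the set as target) and when the game is played on the closed cube $[0,1]^n$ with the set itself as target. Here a subset $S$ of a complete metric space $X$ is $a$-winning if for every $\beta\in(0,1)$ the second player, Alice, has a winning strategy in the following game. Bob chooses a closed ball $B_0$ of any radius $\rho>0$; then, for $t=0,1,2,\dots$, Alice chooses a ball $A_t\subseteq B_t$ whose radius is $a$ times that of $B_t$, and Bob chooses a ball $B_{t+1}\subseteq A_t$ whose radius is $\beta$ times that of $A_t$. Alice wins if $\bigcap_t B_t=\bigcap_t A_t$ meets $S$. (A ball is given by its centre and radius, and the ball with centre $x$ and radius $r$ counts as contained in the ball with centre $y$ and radius $s$ when $d(x,y)+r\le s$.) -/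

import Mathlib

noncomputable section

/-- The distance from a real number to the nearest integer. -/
def distInt (x : ℝ) : ℝ := |x - round x|

/-- The linear forms `L_j(q) = ∑ i, q_i x_{ji}` of an `n × m` real matrix. -/
def linForm {n m : ℕ} (L : Matrix (Fin n) (Fin m) ℝ) (q : Fin m → ℤ) (j : Fin n) : ℝ :=
  ∑ i, (q i : ℝ) * L j i

/-- The weighted badly approximable matrices. Here `‖q‖` is the supremum norm of `q`. -/
def Bad {n : ℕ} (k : Fin n → ℝ) (m : ℕ) : Set (Matrix (Fin n) (Fin m) ℝ) :=
  {L | 0 < ⨅ q : {q : Fin m → ℤ // q ≠ 0},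
    ⨆ j : Fin n, ‖q.1‖ ^ ((m : ℝ) * k j) * distInt (linForm L q.1 j)}

/-- The twisted weighted badly approximable set of a matrix, a subset of `[0,1)^n`. -/
def twistedBad {n m : ℕ} (L : Matrix (Fin n) (Fin m) ℝ) (k : Fin n → ℝ) :
    Set (EuclideanSpace ℝ (Fin n)) :=
  {a | (∀ j, a j ∈ Set.Ico (0 : ℝ) 1) ∧
    0 < ⨅ q : {q : Fin m → ℤ // q ≠ 0},
      ⨆ j : Fin n, ‖q.1‖ ^ ((m : ℝ) * k j) * distInt (linForm L q.1 j - a j)}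

/-- The closed unit cube `[0,1]^n` in Euclidean space, a complete metric space as a subtype. -/
def unitCube (n : ℕ) : Set (EuclideanSpace ℝ (Fin n)) :=
  {a | ∀ j, a j ∈ Set.Icc (0 : ℝ) 1}

/-- The `ℤ^n`-periodic extension to `ℝ^n` of a subset of `[0,1)^n`: the preimage of the set
under reduction modulo one, `ℝ^n → ℝ^n / ℤ^n = [0,1)^n`. -/
def periodicExt {n : ℕ} (S : Set (EuclideanSpace ℝ (Fin n))) :
    Set (EuclideanSpace ℝ (Fin n)) :=
  {a | WithLp.toLp 2 (fun j => Int.fract (a j)) ∈ S}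

/-- The position of Alice's `t`-th ball's centre when she plays the strategy `σ`, Bob's first
radius is `ρ` and the centres of Bob's balls are `b 0, b 1, …`: it depends only on `ρ` and
`b 0, …, b t`. -/
def aliceCentre {X : Type*} (σ : ℝ → (t : ℕ) → (Fin (t + 1) → X) → X)
    (ρ : ℝ) (b : ℕ → X) (t : ℕ) : X :=
  σ ρ t (fun i => b i)

/-- `S` is `(α, β)`-winning for Schmidt's game on the metric space `X`.
Bob chooses a closed ball `B₀` of any radius `ρ > 0`, Alice a ball `A₀ ⊆ B₀` of radius `α ρ`,
Bob a ball `B₁ ⊆ A₀` of radius `α β ρ`, and so on, so that `B_t` has radius `ρ (α β)^t` and `A_t`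
has radius `α ρ (α β)^t`. As in Schmidt's definition a ball is a pair (centre, radius), and
`(x, r)` lies in `(y, s)` when `dist x y + r ≤ s`. `S` is winning when Alice has a strategy that,
against every legal play of Bob, makes only legal moves and forces a point of `S` into the
intersection of all the balls. -/
def IsWinningFor {X : Type*} [MetricSpace X] (α β : ℝ) (S : Set X) : Prop :=
  ∃ σ : ℝ → (t : ℕ) → (Fin (t + 1) → X) → X,
    ∀ ρ : ℝ, 0 < ρ → ∀ b : ℕ → X,
      (∀ t, dist (b (t + 1)) (aliceCentre σ ρ b t) + ρ * (α * β) ^ (t + 1)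
        ≤ α * (ρ * (α * β) ^ t)) →
      (∀ t, dist (aliceCentre σ ρ b t) (b t) + α * (ρ * (α * β) ^ t) ≤ ρ * (α * β) ^ t) ∧
      ∃ x ∈ S, ∀ t, x ∈ Metric.closedBall (b t) (ρ * (α * β) ^ t) ∧
        x ∈ Metric.closedBall (aliceCentre σ ρ b t) (α * (ρ * (α * β) ^ t))

/-- `S` is `α`-winning: it is `(α, β)`-winning for every `β ∈ (0,1)`. -/
def IsWinning {X : Type*} [MetricSpace X] (α : ℝ) (S : Set X) : Prop :=
  ∀ β ∈ Set.Ioo (0 : ℝ) 1, IsWinningFor α β S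

end

/-! Transference turns the hypothesis on L into approximations for the transposed system. At scale
T, the lattice of vectors (q / T, T^(m k_j) (L_j(q) + p_j)) has determinant 1, as the weights sum to
1, and badness keeps its nonzero vectors away from 0. The dual lattice then has no short vectors
either (`exists_dual_lower_bound`), so Minkowski's theorem yields integral u, v with |u_j| ≪ T^(m
k_j), v within O(1/T) of Lᵀu, and one chosen u_j of full order. With the heaviest coordinate chosen,
|u| has exact order T^(m max k); geometric T give vectors w_s with |w_s| ≍ γ^s for any prescribed γ
> 1 (`exists_geometric_sequence`).

If every w_s · α stays δ away from the integers, α is twisted badly approximable: for T a large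
multiple of |q|, the number u · α is congruent modulo 1 to -u · (L(q) - α - p) up to a small error,
so some ‖L_j(q) - α_j‖ is large (`exists_pos_forall_of_distInt_ge`).

Alice thus has to dodge the hyperplanes w_s · x ∈ ℤ, spaced 1 / |w_s| apart. Taking γ = (β/2)^(-2)
gives her two rounds for each s, with balls small against the spacing. After one move of half a
radius her ball may still touch a hyperplane, but Bob's next centre is at least his radius away, and
the second move clears it by a margin comparable to 1 / |w_s| (`norm_mul_le_distInt_of_awayMove`).
In the cube she first dodges the faces, so that later moves stay legal and no coordinate of the
outcome is 1. -/

/-! ### Geometry of numbers: Minkowski's theorem and dual lattices -/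

/-- **Minkowski's theorem on linear forms**, with strict inequalities. -/
theorem exists_int_ne_zero_forall_abs_mulVec_lt {ι : Type*} [Fintype ι] [DecidableEq ι]
    (A : Matrix ι ι ℝ) (hA : A.det ≠ 0) (r : ι → ℝ) (hr : ∀ i, 0 < r i)
    (h : |A.det| < ∏ i, r i) :
    ∃ x : ι → ℤ, x ≠ 0 ∧ ∀ i, |A.mulVec (fun j => (x j : ℝ)) i| < r i := by
  classical
  let b := Pi.basisFun ℝ ι
  let box : Set (ι → ℝ) := Set.pi Set.univ fun i => Set.Ioo (-(r i)) (r i)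
  have hdet : LinearMap.det (Matrix.toLin' A) ≠ 0 := by rwa [LinearMap.det_toLin']
  have hbox : Convex ℝ box := convex_pi fun i _ => convex_Ioo _ _
  have hvol : MeasureTheory.volume (ZSpan.fundamentalDomain b) * 2 ^ Module.finrank ℝ (ι → ℝ) <
      MeasureTheory.volume (Matrix.toLin' A ⁻¹' box) := by
    have h1 : (∏ i, (2 * r i)) = 2 ^ Fintype.card ι * ∏ i, r i := by
      rw [Finset.prod_mul_distrib, Finset.prod_const, Finset.card_univ]
    rw [MeasureTheory.Measure.addHaar_preimage_linearMap _ hdet, LinearMap.det_toLin',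
      ZSpan.fundamentalDomain_pi_basisFun, Real.volume_pi_Ioo, MeasureTheory.volume_pi,
      MeasureTheory.Measure.pi_pi, Module.finrank_fintype_fun_eq_card]
    have h2 : ∀ i, r i - -r i = 2 * r i := fun i => by ring
    simp only [h2, Real.volume_Ico, sub_zero, ENNReal.ofReal_one, Finset.prod_const_one, one_mul]
    rw [← ENNReal.ofReal_prod_of_nonneg (fun i _ => by linarith [hr i]), h1,
      ← ENNReal.ofReal_mul (abs_nonneg _), abs_inv,
      show (2 : ENNReal) ^ Fintype.card ι = ENNReal.ofReal (2 ^ Fintype.card ι) by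
        rw [ENNReal.ofReal_pow (by norm_num)]; simp]
    have hpos : 0 < |A.det| := abs_pos.2 hA
    have hlt : (2 : ℝ) ^ Fintype.card ι <
        |A.det|⁻¹ * (2 ^ Fintype.card ι * ∏ i, r i) := by
      rw [inv_mul_eq_div, lt_div_iff₀ hpos]
      gcongr
    exact (ENNReal.ofReal_lt_ofReal_iff (lt_trans (by positivity) hlt)).2 hlt
  have : Countable (Submodule.span ℤ (Set.range b)).toAddSubgroup :=
    inferInstanceAs (Countable (Submodule.span ℤ (Set.range b)))
  obtain ⟨x, hx0, hx⟩ :=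
    MeasureTheory.exists_ne_zero_mem_lattice_of_measure_mul_two_pow_lt_measure
      (ZSpan.isAddFundamentalDomain' b MeasureTheory.volume)
      (s := Matrix.toLin' A ⁻¹' box)
      (fun x hx => by
        simp only [Set.mem_preimage, map_neg, box, Set.mem_univ_pi, Set.mem_Ioo,
          Pi.neg_apply] at hx ⊢
        exact fun i => ⟨by linarith [(hx i).2], by linarith [(hx i).1]⟩)
      (hbox.linear_preimage _) hvol
  have hmem := (b.mem_span_iff_repr_mem ℤ (x : ι → ℝ)).1 x.2
  choose z hz using hmem
  have hz' : (fun j => (z j : ℝ)) = (x : ι → ℝ) := by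
    ext j
    simpa [b] using hz j
  refine ⟨z, ?_, fun i => ?_⟩
  · rintro rfl
    apply hx0
    ext j
    simpa using (congrFun hz' j).symm
  · rw [hz', abs_lt]
    exact hx i (Set.mem_univ i)

/-- If a lattice has no short nonzero vector, then neither has its dual lattice. -/
theorem exists_dual_lower_bound (ι : Type*) [Fintype ι] [DecidableEq ι] {c : ℝ} (hc : 0 < c) :
    ∃ c' : ℝ, 0 < c' ∧ ∀ B B' : Matrix ι ι ℝ, B.det = 1 → B.transpose * B' = 1 →
      (∀ x : ι → ℤ, x ≠ 0 → ∃ i, c ≤ |B.mulVec (fun j => (x j : ℝ)) i|) →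
      ∀ y : ι → ℤ, y ≠ 0 → ∃ i, c' ≤ |B'.mulVec (fun j => (y j : ℝ)) i| := by
  set η : ℝ := c / (Fintype.card ι + 1) with hη
  have hηpos : 0 < η := by positivity
  refine ⟨η ^ (Fintype.card ι - 1), by positivity, fun B B' hB hBB' hx y hy => ?_⟩
  by_contra! hsmall
  set w : ι → ℝ := B'.mulVec (fun j => (y j : ℝ)) with hw
  -- For integral v this pairing is an integer.
  have hpair : ∀ v : ι → ℝ, w ⬝ᵥ B.mulVec v = ∑ j, (y j : ℝ) * v j := by
    intro v
    rw [Matrix.dotProduct_mulVec, ← Matrix.mulVec_transpose, hw, Matrix.mulVec_mulVec, hBB',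
      Matrix.one_mulVec]
    rfl
  obtain ⟨j0, hj0⟩ : ∃ j, y j ≠ 0 := by
    by_contra! h
    exact hy (funext h)
  have : Nonempty ι := ⟨j0⟩
  obtain ⟨i0, hi0⟩ := Finite.exists_max fun i => |w i|
  have hw0 : w i0 ≠ 0 := by
    intro h0
    have hwz : w = 0 := by
      ext i
      have := hi0 i
      rw [h0, abs_zero] at this
      exact abs_nonpos_iff.1 this
    have := hpair (Pi.single j0 1)
    rw [hwz] at this
    simp [Pi.single_apply] at this
    exact hj0 (by exact_mod_cast this.symm)
  -- The new row is the pairing with w. The determinant becomes w i0, small enough for Minkowski to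
  -- give a lattice vector whose pairing with w is below 1, hence 0, and whose other coordinates are
  -- below η.
  set A : Matrix ι ι ℝ := B.updateRow i0 (∑ k, w k • B k) with hA
  have hAdet : A.det = w i0 := by rw [hA, Matrix.det_updateRow_sum, hB, smul_eq_mul, mul_one]
  have hAi : ∀ v i, i ≠ i0 → A.mulVec v i = B.mulVec v i := by
    intro v i hi
    simp only [hA, Matrix.mulVec, Matrix.updateRow_ne hi]
  have hA0 : ∀ v, A.mulVec v i0 = w ⬝ᵥ B.mulVec v := by
    intro v
    simp only [hA, Matrix.mulVec, Matrix.updateRow_self, sum_dotProduct, smul_dotProduct,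
      smul_eq_mul]
    rfl
  obtain ⟨x, hx0, hxA⟩ := exists_int_ne_zero_forall_abs_mulVec_lt A (hAdet ▸ hw0)
    (Function.update (fun _ => η) i0 1)
    (fun i => by by_cases h : i = i0 <;> simp [h, hηpos])
    (by
      rw [Finset.prod_update_of_mem (Finset.mem_univ _), Finset.prod_const, hAdet, one_mul,
        ← Finset.erase_eq, Finset.card_erase_of_mem (Finset.mem_univ _), Finset.card_univ]
      exact hsmall i0)
  set v : ι → ℝ := fun j => (x j : ℝ) with hv
  have hzero : w ⬝ᵥ B.mulVec v = 0 := by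
    have h1 := hxA i0
    rw [hA0, Function.update_self, hpair] at h1
    rw [hpair]
    have h2 : (∑ j, (y j : ℝ) * v j) = ((∑ j, y j * x j : ℤ) : ℝ) := by simp [hv]
    rw [h2] at h1 ⊢
    have h3 : |∑ j, y j * x j| < 1 := by exact_mod_cast h1
    rw [Int.abs_lt_one_iff.1 h3, Int.cast_zero]
  have hsm : ∀ i, i ≠ i0 → |B.mulVec v i| < η := by
    intro i hi
    have := hxA i
    rwa [hAi _ _ hi, Function.update_of_ne hi] at this
  -- Orthogonality to w expresses coordinate i0 through the others, with ratios at most 1 since |w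
  -- i0| is maximal.
  have hi0' : |B.mulVec v i0| ≤ (Fintype.card ι) * η := by
    rw [dotProduct, ← Finset.add_sum_erase _ _ (Finset.mem_univ i0)] at hzero
    have h1 : |w i0| * |B.mulVec v i0| ≤ |w i0| * (Fintype.card ι * η) := by
      calc |w i0| * |B.mulVec v i0| = |∑ i ∈ Finset.univ.erase i0, w i * B.mulVec v i| := by
            rw [← abs_mul, ← abs_neg]; congr 1; linarith
        _ ≤ ∑ i ∈ Finset.univ.erase i0, |w i * B.mulVec v i| := Finset.abs_sum_le_sum_abs _ _
        _ ≤ ∑ i ∈ Finset.univ.erase i0, |w i0| * η := by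
            refine Finset.sum_le_sum fun i hi => ?_
            rw [abs_mul]
            exact mul_le_mul (hi0 i) (hsm i (Finset.ne_of_mem_erase hi)).le (abs_nonneg _)
              (abs_nonneg _)
        _ ≤ ∑ i : ι, |w i0| * η :=
            Finset.sum_le_sum_of_subset_of_nonneg (Finset.erase_subset _ _)
              fun _ _ _ => by positivity
        _ = _ := by rw [Finset.sum_const, Finset.card_univ, nsmul_eq_mul]; ring
    exact le_of_mul_le_mul_left h1 (abs_pos.2 hw0)
  have hηc : (Fintype.card ι) * η < c := by
    rw [hη, mul_div_assoc', div_lt_iff₀ (by positivity)]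
    nlinarith
  obtain ⟨i, hi⟩ := hx x hx0
  have hcard : (1 : ℝ) ≤ Fintype.card ι := by exact_mod_cast Fintype.card_pos
  by_cases h : i = i0
  · rw [h] at hi
    linarith
  · have := hsm i h
    nlinarith

/-- If a lattice has no short nonzero vector, then its dual lattice has, for each coordinate,
a vector of bounded length in which this coordinate is not small. -/
theorem exists_dual_vector_coord_ge (ι : Type*) [Fintype ι] [DecidableEq ι] {c : ℝ}
    (hc : 0 < c) :
    ∃ c' C : ℝ, 0 < c' ∧ 0 < C ∧ ∀ B B' : Matrix ι ι ℝ, B.det = 1 → B.transpose * B' = 1 →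
      (∀ x : ι → ℤ, x ≠ 0 → ∃ i, c ≤ |B.mulVec (fun j => (x j : ℝ)) i|) →
      ∀ i0, ∃ y : ι → ℤ, (∀ i, |B'.mulVec (fun j => (y j : ℝ)) i| ≤ C) ∧
        c' ≤ |B'.mulVec (fun j => (y j : ℝ)) i0| := by
  obtain ⟨c', hc', H⟩ := exists_dual_lower_bound ι hc
  -- The sides c', except R at i0, have product 2, above det B' = 1.
  set R : ℝ := 2 / c' ^ (Fintype.card ι - 1) with hR
  have hRpos : 0 < R := by positivity
  refine ⟨c', c' + R, hc', by positivity, fun B B' hB hBB' hx i0 => ?_⟩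
  have hB' : B'.det = 1 := by
    have := congrArg Matrix.det hBB'
    rwa [Matrix.det_mul, Matrix.det_transpose, hB, one_mul, Matrix.det_one] at this
  obtain ⟨y, hy0, hy⟩ := exists_int_ne_zero_forall_abs_mulVec_lt B' (by simp [hB'])
    (Function.update (fun _ => c') i0 R)
    (fun i => by by_cases h : i = i0 <;> simp [h, hRpos, hc'])
    (by
      rw [Finset.prod_update_of_mem (Finset.mem_univ _), Finset.prod_const, hB',
        ← Finset.erase_eq, Finset.card_erase_of_mem (Finset.mem_univ _), Finset.card_univ, hR,
        div_mul_cancel₀ _ (by positivity)]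
      norm_num)
  refine ⟨y, fun i => ?_, ?_⟩
  · by_cases h : i = i0
    · subst h
      have := hy i
      rw [Function.update_self] at this
      linarith
    · have := hy i
      rw [Function.update_of_ne h] at this
      linarith
  · obtain ⟨i, hi⟩ := H B B' hB hBB' hx y hy0
    by_cases h : i = i0
    · rwa [h] at hi
    · have := hy i
      rw [Function.update_of_ne h] at this
      linarith

/-! ### Bad approximability and the transposed system -/

theorem distInt_nonneg (x : ℝ) : 0 ≤ distInt x := abs_nonneg _

theorem distInt_le_abs_sub_intCast (x : ℝ) (z : ℤ) : distInt x ≤ |x - z| := round_le x z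

theorem exists_pos_forall_of_mem_Bad {n m : ℕ} {k : Fin n → ℝ} (hn : 0 < n)
    {L : Matrix (Fin n) (Fin m) ℝ} (hL : L ∈ Bad k m) :
    ∃ c : ℝ, 0 < c ∧ ∀ q : Fin m → ℤ, q ≠ 0 →
      ∃ j, c ≤ ‖q‖ ^ ((m : ℝ) * k j) * distInt (linForm L q j) := by
  refine ⟨_, hL, fun q hq => ?_⟩
  have : Nonempty (Fin n) := ⟨⟨0, hn⟩⟩
  obtain ⟨j, hj⟩ := exists_eq_ciSup_of_finite
    (f := fun j : Fin n => ‖q‖ ^ ((m : ℝ) * k j) * distInt (linForm L q j))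
  refine ⟨j, hj ▸ ciInf_le (f := fun q : {q : Fin m → ℤ // q ≠ 0} =>
    ⨆ j : Fin n, ‖q.1‖ ^ ((m : ℝ) * k j) * distInt (linForm L q.1 j)) ⟨0, ?_⟩ ⟨q, hq⟩⟩
  rintro _ ⟨q, rfl⟩
  exact Real.iSup_nonneg fun j =>
    mul_nonneg (Real.rpow_nonneg (norm_nonneg _) _) (distInt_nonneg _)

/-- For a badly approximable matrix, the transposed system has at every scale an approximation
with a prescribed coordinate of the largest possible order. -/
theorem exists_transposed_approximation {n m : ℕ} {k : Fin n → ℝ} (hk : ∀ j, 0 < k j)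
    (hsum : ∑ j, k j = 1) {L : Matrix (Fin n) (Fin m) ℝ} (hL : L ∈ Bad k m) :
    ∃ c C : ℝ, 0 < c ∧ 0 < C ∧ ∀ T : ℝ, 1 ≤ T → ∀ j0 : Fin n,
      ∃ (u : Fin n → ℤ) (v : Fin m → ℤ),
        (∀ j, |(u j : ℝ)| ≤ C * T ^ ((m : ℝ) * k j)) ∧
        (∀ i, |(v i : ℝ) - ∑ j, (u j : ℝ) * L j i| ≤ C / T) ∧
        c * T ^ ((m : ℝ) * k j0) ≤ |(u j0 : ℝ)| := by
  have hn : 0 < n := by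
    rcases Nat.eq_zero_or_pos n with rfl | h
    · simp at hsum
    · exact h
  obtain ⟨c0, hc0, hbad⟩ := exists_pos_forall_of_mem_Bad hn hL
  -- The 1 serves lattice vectors with q = 0, where badness says nothing but a nonzero p_j has D_j
  -- |p_j| ≥ 1.
  have hcpos : 0 < min c0 1 := lt_min hc0 one_pos
  obtain ⟨c', C, hc', hC, H⟩ := exists_dual_vector_coord_ge (Fin m ⊕ Fin n) hcpos
  refine ⟨c', C, hc', hC, fun T hT j0 => ?_⟩
  have hT0 : 0 < T := by linarith
  let D : Fin n → ℝ := fun j => T ^ ((m : ℝ) * k j)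
  have hD : ∀ j, 1 ≤ D j := fun j =>
    Real.one_le_rpow hT (mul_nonneg (Nat.cast_nonneg _) (hk j).le)
  have hD0 : ∀ j, 0 < D j := fun j => by linarith [hD j]
  have hprod : ∏ j, D j = T ^ m := by
    rw [← Real.rpow_sum_of_pos hT0, ← Finset.mul_sum, hsum, mul_one, Real.rpow_natCast]
  let B : Matrix (Fin m ⊕ Fin n) (Fin m ⊕ Fin n) ℝ :=
    Matrix.fromBlocks (Matrix.diagonal fun _ => T⁻¹) 0 (Matrix.diagonal D * L)
      (Matrix.diagonal D)
  -- The inverse transpose of B: it sends (v, u) to (T (v - Lᵀu), u_j / D_j).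
  let B' : Matrix (Fin m ⊕ Fin n) (Fin m ⊕ Fin n) ℝ :=
    Matrix.fromBlocks (Matrix.diagonal fun _ => T) (-(T • L.transpose)) 0
      (Matrix.diagonal fun j => (D j)⁻¹)
  have hB : B.det = 1 := by
    rw [Matrix.det_fromBlocks_zero₁₂, Matrix.det_diagonal, Matrix.det_diagonal, hprod,
      Finset.prod_const, Finset.card_univ, Fintype.card_fin, ← mul_pow, inv_mul_cancel₀ hT0.ne',
      one_pow]
  have hBB' : B.transpose * B' = 1 := by
    rw [Matrix.fromBlocks_transpose, Matrix.fromBlocks_multiply, ← Matrix.fromBlocks_one]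
    congr 1
    · simp [inv_mul_cancel₀ hT0.ne']
    · ext i j
      simp [Matrix.mul_assoc, Matrix.transpose_mul, Matrix.diagonal_mul,
        (hD0 _).ne', hT0.ne']
    · simp
    · simp [(hD0 _).ne']
  have hshort : ∀ x : Fin m ⊕ Fin n → ℤ, x ≠ 0 →
      ∃ i, min c0 1 ≤ |B.mulVec (fun j => (x j : ℝ)) i| := by
    intro x hx
    by_contra! hlt
    have h1 : ∀ i, T⁻¹ * |(x (Sum.inl i) : ℝ)| < min c0 1 := by
      intro i
      have := hlt (Sum.inl i)
      simpa [B, Matrix.fromBlocks_mulVec, Matrix.mulVec_diagonal, abs_mul, abs_of_pos hT0]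
        using this
    have h2 : ∀ j, D j * |linForm L (fun i => x (Sum.inl i)) j + x (Sum.inr j)| < min c0 1 := by
      intro j
      have := hlt (Sum.inr j)
      have heq : B.mulVec (fun j => (x j : ℝ)) (Sum.inr j) =
          D j * (linForm L (fun i => x (Sum.inl i)) j + x (Sum.inr j)) := by
        simp only [B, Matrix.fromBlocks_mulVec, Sum.elim_inr, Pi.add_apply, ← Matrix.mulVec_mulVec,
          Matrix.mulVec_diagonal, linForm, mul_add]
        congr 2
        simp only [Matrix.mulVec, dotProduct]
        exact Finset.sum_congr rfl fun i _ => mul_comm _ _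
      rwa [heq, abs_mul, abs_of_pos (hD0 j)] at this
    by_cases hq : (fun i => x (Sum.inl i)) = 0
    · apply hx
      ext s
      rcases s with i | j
      · exact congrFun hq i
      · have h3 := h2 j
        have h4 : linForm L (fun i => x (Sum.inl i)) j = 0 := by
          rw [hq]; simp [linForm]
        rw [h4, zero_add] at h3
        have h5 : |(x (Sum.inr j) : ℝ)| < 1 := by
          have := min_le_right c0 1
          nlinarith [hD j, abs_nonneg (x (Sum.inr j) : ℝ)]
        have h6 : |x (Sum.inr j)| < 1 := by exact_mod_cast h5
        exact Int.abs_lt_one_iff.1 h6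
    · obtain ⟨j, hj⟩ := hbad _ hq
      have hqT : ‖(fun i => x (Sum.inl i))‖ ≤ T := by
        rw [pi_norm_le_iff_of_nonneg hT0.le]
        intro i
        have := h1 i
        rw [inv_mul_lt_iff₀ hT0] at this
        rw [Int.norm_eq_abs]
        nlinarith [min_le_right c0 1]
      have h3 : distInt (linForm L (fun i => x (Sum.inl i)) j) ≤
          |linForm L (fun i => x (Sum.inl i)) j + x (Sum.inr j)| := by
        simpa using distInt_le_abs_sub_intCast (linForm L (fun i => x (Sum.inl i)) j)
          (-(x (Sum.inr j)))
      have h4 : ‖(fun i => x (Sum.inl i))‖ ^ ((m : ℝ) * k j) ≤ D j :=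
        Real.rpow_le_rpow (norm_nonneg _) hqT (mul_nonneg (Nat.cast_nonneg _) (hk j).le)
      have h5 := mul_le_mul h4 h3 (distInt_nonneg _) (hD0 j).le
      linarith [h2 j, min_le_left c0 1]
  obtain ⟨y, hy, hy0⟩ := H B B' hB hBB' hshort (Sum.inr j0)
  have hr : ∀ j, B'.mulVec (fun s => (y s : ℝ)) (Sum.inr j) = (D j)⁻¹ * y (Sum.inr j) := by
    intro j
    simp [B', Matrix.fromBlocks_mulVec, Matrix.mulVec_diagonal]
  have hl : ∀ i, B'.mulVec (fun s => (y s : ℝ)) (Sum.inl i) =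
      T * (y (Sum.inl i) - ∑ j, (y (Sum.inr j) : ℝ) * L j i) := by
    intro i
    have hsum' : (L.transpose.mulVec ((fun s => (y s : ℝ)) ∘ Sum.inr)) i =
        ∑ j, (y (Sum.inr j) : ℝ) * L j i := by
      simp only [Matrix.mulVec, dotProduct, Function.comp_apply, Matrix.transpose_apply]
      exact Finset.sum_congr rfl fun i _ => mul_comm _ _
    rw [← hsum', Matrix.fromBlocks_mulVec, Sum.elim_inl, Pi.add_apply, Matrix.mulVec_diagonal,
      Matrix.neg_mulVec, Matrix.smul_mulVec, Pi.neg_apply, Pi.smul_apply, smul_eq_mul, mul_sub,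
      sub_eq_add_neg, Function.comp_apply]
  refine ⟨fun j => y (Sum.inr j), fun i => y (Sum.inl i), fun j => ?_, fun i => ?_, ?_⟩
  · have := hy (Sum.inr j)
    rwa [hr, abs_mul, abs_inv, abs_of_pos (hD0 j), inv_mul_le_iff₀ (hD0 j), mul_comm] at this
  · have := hy (Sum.inl i)
    rwa [hl, abs_mul, abs_of_pos hT0, ← le_div_iff₀' hT0] at this
  · rwa [hr, abs_mul, abs_inv, abs_of_pos (hD0 j0), le_inv_mul_iff₀ (hD0 j0), mul_comm] at hy0

/-- If `u · x` stays away from the integers for a sequence of good approximations `u` to the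
transposed system, then `x` is badly approximable by the affine forms of `L`. -/
theorem exists_pos_forall_of_distInt_ge {n m : ℕ} {k : Fin n → ℝ} (hk : ∀ j, 0 < k j)
    (hsum : ∑ j, k j = 1) (L : Matrix (Fin n) (Fin m) ℝ) {C θ δ : ℝ} (hC : 0 < C) (hθ : 1 < θ)
    (hδ : 0 < δ) (u : ℕ → Fin n → ℤ) (v : ℕ → Fin m → ℤ)
    (hu : ∀ s j, |(u s j : ℝ)| ≤ C * (θ ^ s) ^ ((m : ℝ) * k j))
    (hv : ∀ s i, |(v s i : ℝ) - ∑ j, (u s j : ℝ) * L j i| ≤ C / θ ^ s) (x : Fin n → ℝ)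
    (hx : ∀ s, δ ≤ distInt (∑ j, (u s j : ℝ) * x j)) :
    ∃ c : ℝ, 0 < c ∧ ∀ q : Fin m → ℤ, q ≠ 0 →
      ∃ j, c ≤ ‖q‖ ^ ((m : ℝ) * k j) * distInt (linForm L q j - x j) := by
  -- The factor θ is the overshoot in rounding up to a power of θ; the maximum makes the error q ·
  -- (v - Lᵀu) at most δ / 2.
  set K : ℝ := θ * max 1 (2 * m * C / δ) with hK
  have hmax : 1 ≤ max 1 (2 * m * C / δ) := le_max_left _ _
  have hK1 : 1 ≤ K := by nlinarith
  have hn : 0 < n := by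
    rcases Nat.eq_zero_or_pos n with rfl | h
    · simp at hsum
    · exact h
  have hkle : ∀ j, k j ≤ 1 := fun j =>
    hsum ▸ Finset.single_le_sum (fun i _ => (hk i).le) (Finset.mem_univ j)
  have hKm : 0 < K ^ (m : ℝ) := Real.rpow_pos_of_pos (by linarith) _
  have hn' : (0 : ℝ) < n := by exact_mod_cast hn
  -- With |u_j| ≤ C K^m ‖q‖^(m k_j), this makes each of the n terms of u · (L(q) - x - p) less than
  -- δ / (2n).
  refine ⟨δ / (2 * n * (C * K ^ (m : ℝ))), by positivity, fun q hq => ?_⟩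
  by_contra! hlt
  have hQ : 1 ≤ ‖q‖ := by
    obtain ⟨i, hi⟩ : ∃ i, q i ≠ 0 := by
      by_contra! h
      exact hq (funext h)
    refine le_trans ?_ (norm_le_pi_norm q i)
    rw [Int.norm_eq_abs]
    exact_mod_cast Int.one_le_abs hi
  obtain ⟨s, hs1, hs2⟩ :=
    exists_nat_pow_near (x := max 1 (2 * m * C / δ) * ‖q‖) (by nlinarith) hθ
  set T : ℝ := θ ^ (s + 1) with hT
  have hTpos : 0 < T := by positivity
  have hTK : T ≤ K * ‖q‖ := by
    rw [hT, pow_succ, hK]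
    nlinarith
  have hTq : m * (‖q‖ * (C / T)) ≤ δ / 2 := by
    have h1 : 2 * m * C / δ * ‖q‖ ≤ T :=
      le_trans (mul_le_mul_of_nonneg_right (le_max_right _ _) (norm_nonneg _)) hs2.le
    have h2 : m * (‖q‖ * (C / T)) = (2 * m * C / δ * ‖q‖) * (δ / 2) / T := by
      field_simp
    rw [h2, div_le_iff₀ hTpos]
    nlinarith
  set p : Fin n → ℤ := fun j => round (linForm L q j - x j) with hp
  have hdecomp : (∑ j, (u (s + 1) j : ℝ) * x j) -
      ((∑ i, q i * v (s + 1) i - ∑ j, u (s + 1) j * p j : ℤ) : ℝ) =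
      -(∑ j, (u (s + 1) j : ℝ) * (linForm L q j - x j - p j)) -
        ∑ i, (q i : ℝ) * (v (s + 1) i - ∑ j, (u (s + 1) j : ℝ) * L j i) := by
    have hswap : ∑ j, (u (s + 1) j : ℝ) * linForm L q j =
        ∑ i, (q i : ℝ) * ∑ j, (u (s + 1) j : ℝ) * L j i := by
      simp only [linForm, Finset.mul_sum]
      rw [Finset.sum_comm]
      exact Finset.sum_congr rfl fun i _ => Finset.sum_congr rfl fun j _ => by ring
    push_cast
    simp only [mul_sub, Finset.sum_sub_distrib, hswap]
    ring
  have h1 : |∑ i, (q i : ℝ) * (v (s + 1) i - ∑ j, (u (s + 1) j : ℝ) * L j i)| ≤ δ / 2 := by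
    refine le_trans (Finset.abs_sum_le_sum_abs _ _) (le_trans (Finset.sum_le_sum
      (g := fun _ => ‖q‖ * (C / T)) fun i _ => ?_) (by simpa using hTq))
    rw [abs_mul]
    refine mul_le_mul ?_ (hv _ i) (abs_nonneg _) (norm_nonneg _)
    rw [← Int.norm_eq_abs]
    exact norm_le_pi_norm q i
  have h2 : |∑ j, (u (s + 1) j : ℝ) * (linForm L q j - x j - p j)| < δ / 2 := by
    have hne : (Finset.univ : Finset (Fin n)).Nonempty := ⟨⟨0, hn⟩, Finset.mem_univ _⟩
    refine lt_of_le_of_lt (Finset.abs_sum_le_sum_abs _ _)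
      (lt_of_lt_of_le (Finset.sum_lt_sum_of_nonempty
      (g := fun _ => δ / (2 * n)) hne fun j _ => ?_) ?_)
    · rw [abs_mul]
      have hA : |(u (s + 1) j : ℝ)| ≤ C * (K ^ (m : ℝ) * ‖q‖ ^ ((m : ℝ) * k j)) := by
        refine le_trans (hu _ j) (mul_le_mul_of_nonneg_left ?_ hC.le)
        have he : 0 ≤ (m : ℝ) * k j := mul_nonneg (Nat.cast_nonneg _) (hk j).le
        refine le_trans (Real.rpow_le_rpow hTpos.le hTK he) ?_
        rw [Real.mul_rpow (by linarith) (norm_nonneg _)]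
        refine mul_le_mul_of_nonneg_right ?_ (Real.rpow_nonneg (norm_nonneg _) _)
        exact Real.rpow_le_rpow_of_exponent_le hK1
          (mul_le_of_le_one_right (Nat.cast_nonneg _) (hkle j))
      have hB : |linForm L q j - x j - p j| = distInt (linForm L q j - x j) := rfl
      rw [hB]
      calc |(u (s + 1) j : ℝ)| * distInt (linForm L q j - x j)
          ≤ C * (K ^ (m : ℝ) * ‖q‖ ^ ((m : ℝ) * k j)) * distInt (linForm L q j - x j) :=
            mul_le_mul_of_nonneg_right hA (distInt_nonneg _)
        _ = C * K ^ (m : ℝ) * (‖q‖ ^ ((m : ℝ) * k j) * distInt (linForm L q j - x j)) := by ring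
        _ < C * K ^ (m : ℝ) * (δ / (2 * n * (C * K ^ (m : ℝ)))) :=
            mul_lt_mul_of_pos_left (hlt j) (by positivity)
        _ = δ / (2 * n) := by field_simp
    · rw [Finset.sum_const, Finset.card_univ, Fintype.card_fin, nsmul_eq_mul]
      exact le_of_eq (by field_simp)
  have h3 := le_trans (hx (s + 1)) (distInt_le_abs_sub_intCast _
    (∑ i, q i * v (s + 1) i - ∑ j, u (s + 1) j * p j))
  rw [hdecomp, abs_sub_comm, sub_neg_eq_add] at h3
  linarith [abs_add_le (∑ i, (q i : ℝ) * (v (s + 1) i - ∑ j, (u (s + 1) j : ℝ) * L j i))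
    (∑ j, (u (s + 1) j : ℝ) * (linForm L q j - x j - p j))]

/-- Positivity of m makes the index type nonempty; a real infimum over an empty type is 0. -/
theorem iInf_iSup_pos_of_forall_exists {n m : ℕ} (hm : 0 < m) {k : Fin n → ℝ}
    {d : (Fin m → ℤ) → Fin n → ℝ} {c : ℝ} (hc : 0 < c)
    (h : ∀ q : Fin m → ℤ, q ≠ 0 → ∃ j, c ≤ ‖q‖ ^ ((m : ℝ) * k j) * d q j) :
    0 < ⨅ q : {q : Fin m → ℤ // q ≠ 0}, ⨆ j : Fin n, ‖q.1‖ ^ ((m : ℝ) * k j) * d q.1 j := by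
  have : Nonempty {q : Fin m → ℤ // q ≠ 0} :=
    ⟨⟨fun _ => 1, fun h => one_ne_zero (congrFun h ⟨0, hm⟩)⟩⟩
  refine lt_of_lt_of_le hc (le_ciInf fun q => ?_)
  obtain ⟨j, hj⟩ := h q.1 q.2
  exact le_trans hj (le_ciSup
    (f := fun j : Fin n => ‖q.1‖ ^ ((m : ℝ) * k j) * d q.1 j) (Set.finite_range _).bddAbove j)

/-! ### Moves away from hyperplanes -/

theorem distInt_sub_fract (y x : ℝ) : distInt (y - Int.fract x) = distInt (y - x) := by
  have h : y - Int.fract x = y - x + (⌊x⌋ : ℤ) := by rw [Int.fract]; ring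
  rw [h, distInt, distInt, round_add_intCast]
  push_cast
  congr 1
  ring

theorem distInt_le_add_abs_sub (x y : ℝ) : distInt x ≤ distInt y + |x - y| := by
  have h1 := distInt_le_abs_sub_intCast x (round y)
  have h2 : |x - round y| ≤ |x - y| + |y - round y| := abs_sub_le _ _ _
  rw [distInt] at h1 ⊢
  rw [distInt]
  linarith

/-- Moving a real number by `s` away from its nearest integer. -/
theorem min_le_distInt_add_away (y s : ℝ) :
    min (distInt y + s) (1 / 2 - s) ≤
      distInt (y + if (round y : ℝ) ≤ y then s else -s) := by
  have hhalf := abs_le.1 (abs_sub_round y)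
  split_ifs with h
  · have hd : distInt y = y - round y := abs_of_nonneg (by linarith)
    rw [hd]
    -- Either no integer above `round y` becomes nearest, and the distance is at least the old one
    -- plus s, or one does, and it was at least 1/2 away from y.
    rcases le_or_gt (round (y + s)) (round y) with hM | hM
    · have hM' : (round (y + s) : ℝ) ≤ round y := by exact_mod_cast hM
      exact le_trans (min_le_left _ _) (le_trans (by linarith) (le_abs_self _))
    · have hM' : (round y : ℝ) + 1 ≤ round (y + s) := by exact_mod_cast hM
      exact le_trans (min_le_right _ _) (le_trans (by linarith) (neg_le_abs _))
  · push Not at h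
    have hd : distInt y = round y - y := by
      rw [distInt, abs_of_neg (by linarith)]; ring
    rw [hd]
    rcases le_or_gt (round y) (round (y + -s)) with hM | hM
    · have hM' : (round y : ℝ) ≤ round (y + -s) := by exact_mod_cast hM
      exact le_trans (min_le_left _ _) (le_trans (by linarith) (neg_le_abs _))
    · have hM' : (round (y + -s) : ℝ) + 1 ≤ round y := by exact_mod_cast hM
      exact le_trans (min_le_right _ _) (le_trans (by linarith) (le_abs_self _))

section Moves

variable {E : Type*} [NormedAddCommGroup E] [InnerProductSpace ℝ E]

/-- From a ball with centre `y` and radius `r`, move by `r / 2` away from the nearest of the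
hyperplanes on which the inner product with `w` is an integer. -/
noncomputable def awayMove (w : E) (r : ℝ) (y : E) : E :=
  y + ((if (round (inner ℝ w y) : ℝ) ≤ inner ℝ w y then ‖w‖ * (r / 2) else -(‖w‖ * (r / 2))) /
    ‖w‖ ^ 2) • w

theorem dist_awayMove_le (w : E) {r : ℝ} (hr : 0 ≤ r) (y : E) :
    dist (awayMove w r y) y ≤ r / 2 := by
  rw [awayMove, dist_eq_norm, add_sub_cancel_left, norm_smul, norm_div, norm_pow, norm_norm]
  have h : ‖(if (round (inner ℝ w y) : ℝ) ≤ inner ℝ w y then ‖w‖ * (r / 2)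
      else -(‖w‖ * (r / 2)))‖ = ‖w‖ * (r / 2) := by
    have h0 : 0 ≤ ‖w‖ * (r / 2) := by positivity
    split_ifs <;> simp [abs_of_nonneg hr]
  rw [h]
  -- For w = 0 the move is trivial.
  rcases eq_or_ne ‖w‖ 0 with h0 | h0
  · rw [h0]; simp; linarith
  · exact le_of_eq (by field_simp)

theorem inner_awayMove {w : E} (hw : w ≠ 0) (r : ℝ) (y : E) :
    inner ℝ w (awayMove w r y) = inner ℝ w y +
      if (round (inner ℝ w y) : ℝ) ≤ inner ℝ w y then ‖w‖ * (r / 2) else -(‖w‖ * (r / 2)) := by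
  rw [awayMove, inner_add_right, inner_smul_right, real_inner_self_eq_norm_sq,
    div_mul_cancel₀ _ (pow_ne_zero 2 (norm_ne_zero_iff.2 hw))]

theorem distInt_inner_le (w x y : E) :
    distInt (inner ℝ w x) ≤ distInt (inner ℝ w y) + ‖w‖ * dist x y := by
  refine le_trans (distInt_le_add_abs_sub _ _) (add_le_add_right ?_ _)
  rw [← inner_sub_right, dist_eq_norm]
  exact abs_real_inner_le_norm _ _

/-- Two consecutive moves away from the hyperplanes of `w` keep the play away from all of them. -/
theorem norm_mul_le_distInt_of_awayMove {w : E} (hw : w ≠ 0) {r r' : ℝ}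
    (hwr : ‖w‖ * r ≤ 1 / 2) {y y' x : E} (hy' : dist y' (awayMove w r y) + r' ≤ r / 2)
    (hx : dist x (awayMove w r' y') ≤ r' / 2) : ‖w‖ * r' ≤ distInt (inner ℝ w x) := by
  have hw0 : 0 ≤ ‖w‖ := norm_nonneg w
  have hrr : r' ≤ r / 2 := by linarith [dist_nonneg (x := y') (y := awayMove w r y)]
  have h1 := min_le_distInt_add_away (inner ℝ w y) (‖w‖ * (r / 2))
  rw [← inner_awayMove hw] at h1
  have h2 := min_le_distInt_add_away (inner ℝ w y') (‖w‖ * (r' / 2))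
  rw [← inner_awayMove hw] at h2
  have h3 := distInt_inner_le w (awayMove w r y) y'
  have h4 := distInt_inner_le w (awayMove w r' y') x
  rw [dist_comm] at h3 h4
  have h5 : ‖w‖ * dist y' (awayMove w r y) ≤ ‖w‖ * (r / 2 - r') :=
    mul_le_mul_of_nonneg_left (by linarith) hw0
  have h6 : ‖w‖ * dist x (awayMove w r' y') ≤ ‖w‖ * (r' / 2) :=
    mul_le_mul_of_nonneg_left hx hw0
  have h7 : ‖w‖ * r' ≤ ‖w‖ * (r / 2) := mul_le_mul_of_nonneg_left hrr hw0
  have h8 : ‖w‖ * (r / 2) ≤ min (distInt (inner ℝ w y) + ‖w‖ * (r / 2))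
      (1 / 2 - ‖w‖ * (r / 2)) :=
    le_min (by linarith [distInt_nonneg (inner ℝ w y)]) (by linarith)
  -- Alice's first ball may touch a hyperplane, but the centre of a ball of radius r' inside it
  -- cannot come closer than r'.
  have h9 : ‖w‖ * r' ≤ distInt (inner ℝ w y') := by linarith
  have h10 : ‖w‖ * r' + ‖w‖ * (r' / 2) ≤ min (distInt (inner ℝ w y') + ‖w‖ * (r' / 2))
      (1 / 2 - ‖w‖ * (r' / 2)) := le_min (by linarith) (by linarith)
  linarith

end Moves

/-! ### Moves away from the faces of the cube -/

theorem abs_sub_le_dist {n : ℕ} (x y : EuclideanSpace ℝ (Fin n)) (j : Fin n) :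
    |x j - y j| ≤ dist x y := by
  rw [dist_eq_norm, ← PiLp.sub_apply, ← Real.norm_eq_abs]
  exact PiLp.norm_apply_le _ j

/-- From a ball with centre `y` and radius `r`, move by `r / 2` along the coordinate `j` away from
the nearer of the faces `y j = 0` and `y j = 1` of the unit cube. -/
noncomputable def faceMove {n : ℕ} (j : Fin n) (r : ℝ) (y : EuclideanSpace ℝ (Fin n)) :
    EuclideanSpace ℝ (Fin n) :=
  y + EuclideanSpace.single j (if y j ≤ 1 / 2 then r / 2 else -(r / 2))

theorem dist_faceMove_le {n : ℕ} (j : Fin n) {r : ℝ} (hr : 0 ≤ r)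
    (y : EuclideanSpace ℝ (Fin n)) : dist (faceMove j r y) y ≤ r / 2 := by
  rw [faceMove, dist_eq_norm, add_sub_cancel_left, PiLp.norm_single]
  split_ifs <;> simp [abs_of_nonneg hr]

theorem faceMove_apply_self {n : ℕ} (j : Fin n) (r : ℝ) (y : EuclideanSpace ℝ (Fin n)) :
    faceMove j r y j = y j + if y j ≤ 1 / 2 then r / 2 else -(r / 2) := by
  simp [faceMove]

theorem faceMove_apply_of_ne {n : ℕ} {i j : Fin n} (h : i ≠ j) (r : ℝ)
    (y : EuclideanSpace ℝ (Fin n)) : faceMove j r y i = y i := by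
  simp [faceMove, h]

theorem faceMove_mem_unitCube {n : ℕ} (j : Fin n) {r : ℝ} (hr0 : 0 ≤ r) (hr : r ≤ 1 / 2)
    {y : EuclideanSpace ℝ (Fin n)} (hy : y ∈ unitCube n) : faceMove j r y ∈ unitCube n := by
  intro i
  by_cases h : i = j
  · subst h
    have := hy i
    rw [faceMove_apply_self]
    split_ifs <;> constructor <;> linarith [this.1, this.2]
  · rw [faceMove_apply_of_ne h]
    exact hy i

/-- After a move away from the faces, the next ball lies between them. -/
theorem mem_Icc_of_faceMove {n : ℕ} {j : Fin n} {r r' : ℝ} (hr : r ≤ 1 / 2)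
    {y y' : EuclideanSpace ℝ (Fin n)} (hy : y j ∈ Set.Icc (0 : ℝ) 1)
    (hy' : dist y' (faceMove j r y) + r' ≤ r / 2) : y' j ∈ Set.Icc r' (1 - r') := by
  have h := abs_le.1 (abs_sub_le_dist y' (faceMove j r y) j)
  rw [faceMove_apply_self] at h
  split_ifs at h <;> constructor <;> linarith [hy.1, hy.2, h.1, h.2]

/-- One face move only confines the next ball to the closed interval, where 1 may still be reached;
a second one excludes it. -/
theorem lt_one_of_faceMove {n : ℕ} {j : Fin n} {r : ℝ} (hr0 : 0 < r) (hr : r < 1 / 2)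
    {x y : EuclideanSpace ℝ (Fin n)} (hy : y j ∈ Set.Icc r (1 - r))
    (hx : dist x (faceMove j r y) ≤ r / 2) : x j < 1 := by
  have h := abs_le.1 (abs_sub_le_dist x (faceMove j r y) j)
  rw [faceMove_apply_self] at h
  split_ifs at h <;> linarith [hy.1, hy.2, h.1, h.2]

/-! ### Positional strategies in Schmidt's game -/

/-- The balls of a legal play are nested. -/
theorem dist_add_le_of_play {E : Type*} [PseudoMetricSpace E] {r : ℕ → ℝ} {a b : ℕ → E}
    (ha : ∀ t, dist (a t) (b t) ≤ r t / 2) {s t : ℕ} (hst : s ≤ t)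
    (hb : ∀ i < t, dist (b (i + 1)) (a i) + r (i + 1) ≤ r i / 2) :
    dist (b t) (b s) + r t ≤ r s := by
  induction t, hst using Nat.le_induction with
  | base => simp
  | succ t hst ih =>
    have h1 := ih fun i hi => hb i (by omega)
    linarith [hb t (by omega), ha t, dist_triangle (b (t + 1)) (a t) (b s),
      dist_triangle (a t) (b t) (b s)]

/-- A rule for Alice's moves that depends only on the first radius, the time and the centre of
Bob's last ball wins, if it is stated in a space `E` that contains `X`, never leaves `X`, and
forces the outcome of the game into the target. -/
theorem isWinningFor_of_rule {X E : Type*} [MetricSpace X] [CompleteSpace X] [MetricSpace E]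
    {β : ℝ} (hβ : β ∈ Set.Ioo (0 : ℝ) 1) {φ : X → E} (hφ : Isometry φ) {S : Set X}
    (g : ℝ → ℕ → E → E)
    (hg : ∀ ρ, 0 < ρ → ∀ t y, dist (g ρ t y) y ≤ ρ * (1 / 2 * β) ^ t / 2)
    (hreach : ∀ ρ, 0 < ρ → ∀ (b : ℕ → X) (t : ℕ), (∀ i < t, dist (φ (b (i + 1)))
      (g ρ i (φ (b i))) + ρ * (1 / 2 * β) ^ (i + 1) ≤ ρ * (1 / 2 * β) ^ i / 2) →
      g ρ t (φ (b t)) ∈ Set.range φ)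
    (hwin : ∀ ρ, 0 < ρ → ∀ b : ℕ → X, (∀ i, dist (φ (b (i + 1)))
      (g ρ i (φ (b i))) + ρ * (1 / 2 * β) ^ (i + 1) ≤ ρ * (1 / 2 * β) ^ i / 2) →
      ∀ x : X, (∀ t, dist (φ x) (g ρ t (φ (b t))) ≤ ρ * (1 / 2 * β) ^ t / 2) → x ∈ S) :
    IsWinningFor (1 / 2) β S := by
  classical
  -- The default y is never used in a legal play, by `hreach`.
  let f : ℝ → ℕ → X → X := fun ρ t y =>
    if h : g ρ t (φ y) ∈ Set.range φ then h.choose else y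
  refine ⟨fun ρ t b => f ρ t (b (Fin.last t)), fun ρ hρ b hb => ?_⟩
  have hcentre : ∀ t, aliceCentre (fun ρ t b => f ρ t (b (Fin.last t))) ρ b t = f ρ t (b t) :=
    fun t => rfl
  simp only [hcentre] at hb ⊢
  have hf : ∀ t, g ρ t (φ (b t)) ∈ Set.range φ → φ (f ρ t (b t)) = g ρ t (φ (b t)) := by
    intro t h
    simp only [f, dif_pos h]
    exact h.choose_spec
  have hstep : ∀ t, φ (f ρ t (b t)) = g ρ t (φ (b t)) := by
    intro t
    induction t using Nat.strong_induction_on with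
    | _ t ih =>
      refine hf t (hreach ρ hρ b t fun i hi => ?_)
      rw [← ih i hi, hφ.dist_eq]
      linarith [hb i]
  have hq0 : 0 < 1 / 2 * β := by linarith [hβ.1]
  have hq1 : 1 / 2 * β < 1 := by linarith [hβ.2]
  have ha : ∀ t, dist (f ρ t (b t)) (b t) ≤ ρ * (1 / 2 * β) ^ t / 2 := by
    intro t
    rw [← hφ.dist_eq, hstep]
    exact hg ρ hρ t _
  have hb' : ∀ t, dist (b (t + 1)) (f ρ t (b t)) + ρ * (1 / 2 * β) ^ (t + 1) ≤
      ρ * (1 / 2 * β) ^ t / 2 := fun t => by linarith [hb t]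
  have hrpos : ∀ t, 0 < ρ * (1 / 2 * β) ^ t := fun t => by positivity
  have hcauchy : CauchySeq b := by
    refine cauchySeq_of_le_geometric (1 / 2 * β) ρ hq1 fun t => ?_
    rw [dist_comm]
    linarith [hb' t, ha t, hrpos (t + 1), dist_triangle (b (t + 1)) (f ρ t (b t)) (b t)]
  obtain ⟨x, hx⟩ := cauchySeq_tendsto_of_complete hcauchy
  have hxa : ∀ t, dist x (f ρ t (b t)) ≤ ρ * (1 / 2 * β) ^ t / 2 := by
    intro t
    refine le_of_tendsto (hx.dist tendsto_const_nhds) ?_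
    -- From time t + 1 on, Bob's centres lie in Alice's t-th ball.
    filter_upwards [Filter.eventually_ge_atTop (t + 1)] with s hs
    have h1 := dist_add_le_of_play (r := fun t => ρ * (1 / 2 * β) ^ t)
      (a := fun t => f ρ t (b t)) ha hs fun i _ => hb' i
    linarith [hb' t, hrpos s, dist_triangle (b s) (b (t + 1)) (f ρ t (b t))]
  refine ⟨fun t => by linarith [ha t], x, hwin ρ hρ b (fun i => ?_) x (fun t => ?_), fun t => ?_⟩
  · rw [← hstep, hφ.dist_eq]
    exact hb' i
  · rw [← hstep, hφ.dist_eq]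
    exact hxa t
  · rw [Metric.mem_closedBall, Metric.mem_closedBall]
    constructor
    · linarith [hxa t, ha t, dist_triangle x (f ρ t (b t)) (b t)]
    · linarith [hxa t]

/-! ### Integer vectors of geometric growth -/

theorem norm_le_card_mul_of_forall_abs_le {n : ℕ} {M : ℝ} (hM : 0 ≤ M)
    (x : EuclideanSpace ℝ (Fin n)) (h : ∀ j, |x j| ≤ M) : ‖x‖ ≤ n * M := by
  rw [EuclideanSpace.norm_eq]
  refine Real.sqrt_le_iff.2 ⟨by positivity, ?_⟩
  refine le_trans (Finset.sum_le_sum (g := fun _ => M ^ 2) fun j _ => ?_) ?_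
  · rw [Real.norm_eq_abs]
    exact pow_le_pow_left₀ (abs_nonneg _) (h j) 2
  · rw [Finset.sum_const, Finset.card_univ, Fintype.card_fin, nsmul_eq_mul, mul_pow]
    refine mul_le_mul_of_nonneg_right ?_ (by positivity)
    exact_mod_cast Nat.le_self_pow two_ne_zero n

/-- For a badly approximable matrix there is a sequence of integer vectors, growing exactly like
a given geometric sequence, such that points avoiding neighbourhoods of all the hyperplanes on
which these vectors have an integral inner product are twisted badly approximable. -/
theorem exists_geometric_sequence {n m : ℕ} (hm : 0 < m) {k : Fin n → ℝ} (hk : ∀ j, 0 < k j)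
    (hsum : ∑ j, k j = 1) {L : Matrix (Fin n) (Fin m) ℝ} (hL : L ∈ Bad k m) {γ : ℝ}
    (hγ : 1 < γ) :
    ∃ c C : ℝ, 0 < c ∧ ∃ w : ℕ → EuclideanSpace ℝ (Fin n),
      (∀ s, c * γ ^ s ≤ ‖w s‖ ∧ ‖w s‖ ≤ C * γ ^ s) ∧
      ∀ (x : EuclideanSpace ℝ (Fin n)) (δ : ℝ), 0 < δ →
        (∀ s, δ ≤ distInt (inner ℝ (w s) x)) → ∃ c' : ℝ, 0 < c' ∧ ∀ q : Fin m → ℤ, q ≠ 0 →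
          ∃ j, c' ≤ ‖q‖ ^ ((m : ℝ) * k j) * distInt (linForm L q j - x j) := by
  obtain ⟨c, C, hc, hC, H⟩ := exists_transposed_approximation hk hsum hL
  have : Nonempty (Fin n) := by
    by_contra h
    rw [not_nonempty_iff] at h
    simp at hsum
  -- The heaviest coordinate dominates the upper bounds for all the others, as T ≥ 1, so its lower
  -- bound fixes the order of the norm.
  obtain ⟨j0, hj0⟩ := Finite.exists_max k
  have hm' : (0 : ℝ) < m := by exact_mod_cast hm
  have he : 0 < (m : ℝ) * k j0 := mul_pos hm' (hk j0)
  set θ : ℝ := γ ^ ((m : ℝ) * k j0)⁻¹ with hθdef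
  have hθ : 1 < θ := Real.one_lt_rpow hγ (inv_pos.2 he)
  have hθ1 : ∀ s : ℕ, 1 ≤ θ ^ s := fun s => one_le_pow₀ hθ.le
  have hpow : ∀ s : ℕ, (θ ^ s) ^ ((m : ℝ) * k j0) = γ ^ s := by
    intro s
    have h : θ ^ ((m : ℝ) * k j0) = γ := by
      rw [hθdef, ← Real.rpow_mul (by linarith), inv_mul_cancel₀ he.ne', Real.rpow_one]
    rw [← Real.rpow_natCast, ← Real.rpow_mul (by linarith), mul_comm (s : ℝ), Real.rpow_mul
      (by linarith), h, Real.rpow_natCast]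
  choose u v hu hv hu0 using fun s : ℕ => H (θ ^ s) (hθ1 s) j0
  refine ⟨c, n * C, hc, fun s => WithLp.toLp 2 fun j => (u s j : ℝ), fun s => ⟨?_, ?_⟩,
    fun x δ hδ hx => ?_⟩
  · rw [← hpow]
    refine le_trans (hu0 s) ?_
    rw [← Real.norm_eq_abs]
    exact PiLp.norm_apply_le (WithLp.toLp 2 fun j => (u s j : ℝ)) j0
  · rw [mul_assoc, ← hpow]
    refine norm_le_card_mul_of_forall_abs_le (by positivity) _ fun j => le_trans (hu s j) ?_
    refine mul_le_mul_of_nonneg_left ?_ hC.le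
    exact Real.rpow_le_rpow_of_exponent_le (hθ1 s) (mul_le_mul_of_nonneg_left (hj0 j) hm'.le)
  · refine exists_pos_forall_of_distInt_ge hk hsum L hC hθ hδ u v hu hv x fun s => ?_
    have h : inner ℝ (WithLp.toLp 2 fun j => (u s j : ℝ)) x = ∑ j, (u s j : ℝ) * x j := by
      simp [PiLp.inner_apply, mul_comm]
    rw [← h]
    exact hx s

/-! ### Alice's strategy -/

/-- Alice's rule: wait until the time `t₀`, then move twice away from the faces of the unit cube
in each coordinate, then twice away from the hyperplanes of each of the vectors `w s`. -/
noncomputable def playRule {n : ℕ} (w : ℕ → EuclideanSpace ℝ (Fin n)) (t₀ : ℕ) (r : ℝ) (t : ℕ)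
    (y : EuclideanSpace ℝ (Fin n)) : EuclideanSpace ℝ (Fin n) :=
  if t < t₀ then y
  else if h : (t - t₀) / 2 < n then faceMove ⟨(t - t₀) / 2, h⟩ r y
  else awayMove (w ((t - t₀) / 2 - n)) r y

section PlayRule

variable {n : ℕ} (w : ℕ → EuclideanSpace ℝ (Fin n)) (t₀ : ℕ)

theorem dist_playRule_le {r : ℝ} (hr : 0 ≤ r) (t : ℕ) (y : EuclideanSpace ℝ (Fin n)) :
    dist (playRule w t₀ r t y) y ≤ r / 2 := by
  unfold playRule
  split_ifs
  · rw [dist_self]; linarith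
  · exact dist_faceMove_le _ hr _
  · exact dist_awayMove_le _ hr _

theorem playRule_face (j : Fin n) {i : ℕ} (hi : i < 2) (r : ℝ) (y : EuclideanSpace ℝ (Fin n)) :
    playRule w t₀ r (t₀ + 2 * j + i) y = faceMove j r y := by
  have h1 : ¬ t₀ + 2 * (j : ℕ) + i < t₀ := by omega
  have h2 : (t₀ + 2 * (j : ℕ) + i - t₀) / 2 = j := by omega
  have h3 : (t₀ + 2 * (j : ℕ) + i - t₀) / 2 < n := lt_of_eq_of_lt h2 j.2
  rw [playRule, if_neg h1, dif_pos h3]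
  congr 1
  exact Fin.ext h2

theorem playRule_away (s : ℕ) {i : ℕ} (hi : i < 2) (r : ℝ) (y : EuclideanSpace ℝ (Fin n)) :
    playRule w t₀ r (t₀ + 2 * (n + s) + i) y = awayMove (w s) r y := by
  have h1 : ¬ t₀ + 2 * (n + s) + i < t₀ := by omega
  have h3 : ¬ (t₀ + 2 * (n + s) + i - t₀) / 2 < n := by omega
  have h4 : (t₀ + 2 * (n + s) + i - t₀) / 2 - n = s := by omega
  rw [playRule, if_neg h1, dif_neg h3, h4]

variable {w t₀} {r : ℕ → ℝ} {b : ℕ → EuclideanSpace ℝ (Fin n)}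

theorem mem_Icc_of_playRule (hr : ∀ t, t₀ ≤ t → r t ≤ 1 / 2) (hcube : ∀ t, b t ∈ unitCube n)
    (j : Fin n) (hb : dist (b (t₀ + 2 * j + 1)) (playRule w t₀ (r (t₀ + 2 * j)) (t₀ + 2 * j)
      (b (t₀ + 2 * j))) + r (t₀ + 2 * j + 1) ≤ r (t₀ + 2 * j) / 2) :
    b (t₀ + 2 * j + 1) j ∈ Set.Icc (r (t₀ + 2 * j + 1)) (1 - r (t₀ + 2 * j + 1)) := by
  have := playRule_face w t₀ j (i := 0) (by norm_num) (r (t₀ + 2 * j)) (b (t₀ + 2 * j))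
  rw [add_zero] at this
  rw [this] at hb
  exact mem_Icc_of_faceMove (hr _ (by omega)) (hcube _ j) hb

/-- Under Alice's rule, a play in the unit cube does not leave it. -/
theorem playRule_mem_unitCube (hr0 : ∀ t, 0 < r t) (hr : ∀ t, t₀ ≤ t → r t ≤ 1 / 2)
    (hcube : ∀ t, b t ∈ unitCube n) (t : ℕ)
    (hb : ∀ i < t, dist (b (i + 1)) (playRule w t₀ (r i) i (b i)) + r (i + 1) ≤ r i / 2) :
    playRule w t₀ (r t) t (b t) ∈ unitCube n := by
  rcases lt_or_ge t t₀ with ht | ht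
  · rw [playRule, if_pos ht]
    exact hcube t
  by_cases h : (t - t₀) / 2 < n
  · rw [playRule, if_neg (by omega), dif_pos h]
    exact faceMove_mem_unitCube _ (hr0 t).le (hr t ht) (hcube t)
  -- After the first face move for j, the j-th coordinates of Bob's ball lie in [0, 1], and all
  -- later balls are nested in it.
  · intro j
    have hj : t₀ + 2 * (j : ℕ) + 1 ≤ t := by have := j.2; omega
    have h1 := mem_Icc_of_playRule hr hcube j (hb (t₀ + 2 * j) (by omega))
    have h2 := dist_add_le_of_play (r := r) (b := b) (fun t => dist_playRule_le w t₀ (hr0 t).le t _)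
      hj hb
    have h3 := dist_playRule_le w t₀ (hr0 t).le t (b t)
    have h4 := abs_le.1 (abs_sub_le_dist (playRule w t₀ (r t) t (b t))
      (b (t₀ + 2 * (j : ℕ) + 1)) j)
    have h5 := dist_triangle (playRule w t₀ (r t) t (b t)) (b t) (b (t₀ + 2 * (j : ℕ) + 1))
    constructor <;> linarith [h1.1, h1.2, h4.1, h4.2, hr0 t]

theorem lt_one_of_playRule
    (hb : ∀ i, dist (b (i + 1)) (playRule w t₀ (r i) i (b i)) + r (i + 1) ≤ r i / 2)
    {x : EuclideanSpace ℝ (Fin n)} (hx : ∀ t, dist x (playRule w t₀ (r t) t (b t)) ≤ r t / 2)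
    (hr0 : ∀ t, 0 < r t) (hr : ∀ t, t₀ ≤ t → r t < 1 / 2)
    (hcube : ∀ t, b t ∈ unitCube n) (j : Fin n) : x j < 1 := by
  have h1 := mem_Icc_of_playRule (fun t ht => (hr t ht).le) hcube j (hb (t₀ + 2 * j))
  have h2 := hx (t₀ + 2 * j + 1)
  rw [playRule_face w t₀ j (by norm_num)] at h2
  exact lt_one_of_faceMove (hr0 _) (hr _ (by omega)) h1 h2

theorem le_distInt_of_playRule
    (hb : ∀ i, dist (b (i + 1)) (playRule w t₀ (r i) i (b i)) + r (i + 1) ≤ r i / 2)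
    {x : EuclideanSpace ℝ (Fin n)} (hx : ∀ t, dist x (playRule w t₀ (r t) t (b t)) ≤ r t / 2)
    (s : ℕ) (hw : w s ≠ 0)
    (hws : ‖w s‖ * r (t₀ + 2 * (n + s)) ≤ 1 / 2) :
    ‖w s‖ * r (t₀ + 2 * (n + s) + 1) ≤ distInt (inner ℝ (w s) x) := by
  have h1 := hb (t₀ + 2 * (n + s))
  have h2 := hx (t₀ + 2 * (n + s) + 1)
  have h0 := playRule_away w t₀ s (i := 0) (by norm_num) (r (t₀ + 2 * (n + s)))
    (b (t₀ + 2 * (n + s)))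
  rw [add_zero] at h0
  rw [h0] at h1
  rw [playRule_away w t₀ s (by norm_num)] at h2
  exact norm_mul_le_distInt_of_awayMove hw hws h1 h2

end PlayRule

/-! ### The winning property -/

/-- Schmidt's game on the whole space or on the unit cube, for a target containing all points that
are twisted badly approximable and, in the case of the cube, have no coordinate equal to `1`. -/
theorem isWinning_of_mem_Bad {n m : ℕ} (hm : 0 < m) {k : Fin n → ℝ} (hk : ∀ j, 0 < k j)
    (hsum : ∑ j, k j = 1) {L : Matrix (Fin n) (Fin m) ℝ} (hL : L ∈ Bad k m)
    {X : Type*} [MetricSpace X] [CompleteSpace X] {φ : X → EuclideanSpace ℝ (Fin n)}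
    (hφ : Isometry φ) (hrange : Set.range φ = Set.univ ∨ Set.range φ = unitCube n) {S : Set X}
    (hS : ∀ x : X, (∃ c : ℝ, 0 < c ∧ ∀ q : Fin m → ℤ, q ≠ 0 →
      ∃ j, c ≤ ‖q‖ ^ ((m : ℝ) * k j) * distInt (linForm L q j - φ x j)) →
      (Set.range φ = unitCube n → ∀ j, φ x j < 1) → x ∈ S) :
    IsWinning (1 / 2) S := by
  intro β hβ
  set q : ℝ := 1 / 2 * β with hq
  have hq0 : 0 < q := by linarith [hβ.1]
  have hq1 : q < 1 := by linarith [hβ.2]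
  -- Radii shrink by q² over the two rounds spent on each vector, so this growth keeps ‖w s‖ times
  -- the radius bounded above and below.
  have hγ : 1 < (q ^ 2)⁻¹ := (one_lt_inv₀ (by positivity)).2 (by nlinarith)
  obtain ⟨c, C, hc, w, hw, hwin⟩ := exists_geometric_sequence hm hk hsum hL hγ
  -- The first bound is for the face moves; the second gives ‖w s‖ r ≤ 1/2 at the turn of every w s.
  have hlim : ∀ ρ : ℝ, ∃ t₀ : ℕ, ρ * q ^ t₀ < 1 / 2 ∧ C * (ρ * q ^ t₀) ≤ 1 / 2 := by
    intro ρ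
    have h1 : Filter.Tendsto (fun t : ℕ => ρ * q ^ t) Filter.atTop (nhds 0) := by
      simpa using (tendsto_pow_atTop_nhds_zero_of_lt_one hq0.le hq1).const_mul ρ
    have h2 : Filter.Tendsto (fun t : ℕ => C * (ρ * q ^ t)) Filter.atTop (nhds 0) := by
      simpa using h1.const_mul C
    exact ((h1.eventually_lt_const (by norm_num)).and
      (h2.eventually_le_const (by norm_num))).exists
  choose t₀ ht₀ ht₀' using hlim
  have hr0 : ∀ ρ, 0 < ρ → ∀ t, 0 < ρ * q ^ t := fun ρ hρ t => by positivity
  have hr : ∀ ρ, 0 < ρ → ∀ t, t₀ ρ ≤ t → ρ * q ^ t < 1 / 2 := fun ρ hρ t ht =>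
    lt_of_le_of_lt (mul_le_mul_of_nonneg_left (pow_le_pow_of_le_one hq0.le hq1.le ht) hρ.le)
      (ht₀ ρ)
  refine isWinningFor_of_rule hβ hφ (fun ρ t y => playRule w (t₀ ρ) (ρ * q ^ t) t y)
    (fun ρ hρ t y => dist_playRule_le w _ (hr0 ρ hρ t).le t y) (fun ρ hρ b t hb => ?_)
    fun ρ hρ b hb x hx => ?_
  · rcases hrange with h | h
    · rw [h]
      exact Set.mem_univ _
    · rw [h]
      exact playRule_mem_unitCube (r := fun t => ρ * q ^ t) (b := fun t => φ (b t)) (hr0 ρ hρ)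
        (fun t ht => (hr ρ hρ t ht).le) (fun t => h ▸ Set.mem_range_self _) t hb
  -- The margin for w s is ‖w s‖ times the radius at the second of its two rounds; by ‖w s‖ q^(2s) ≥
  -- c it is bounded below independently of s.
  · refine hS x (hwin (φ x) (c * (ρ * q ^ (t₀ ρ + 2 * n + 1))) (by positivity) fun s => ?_)
      fun h => lt_one_of_playRule (r := fun t => ρ * q ^ t) (b := fun t => φ (b t)) hb hx
        (hr0 ρ hρ) (hr ρ hρ) fun t => h ▸ Set.mem_range_self _
    have hqs : (q ^ 2)⁻¹ ^ s * q ^ (2 * s) = 1 := by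
      rw [pow_mul, ← mul_pow, inv_mul_cancel₀ (by positivity), one_pow]
    have hws : w s ≠ 0 := by
      rw [← norm_pos_iff]
      exact lt_of_lt_of_le (by positivity) (hw s).1
    have hlow : c ≤ ‖w s‖ * q ^ (2 * s) := by
      have := mul_le_mul_of_nonneg_right (hw s).1 (pow_pos hq0 (2 * s)).le
      rwa [mul_assoc, hqs, mul_one] at this
    have hup : ‖w s‖ * q ^ (2 * s) ≤ C := by
      have := mul_le_mul_of_nonneg_right (hw s).2 (pow_pos hq0 (2 * s)).le
      rwa [mul_assoc, hqs, mul_one] at this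
    refine le_trans ?_ (le_distInt_of_playRule (r := fun t => ρ * q ^ t)
      (b := fun t => φ (b t)) hb hx s hws ?_)
    · have h1 : ‖w s‖ * (ρ * q ^ (t₀ ρ + 2 * (n + s) + 1)) =
          ‖w s‖ * q ^ (2 * s) * (ρ * q ^ (t₀ ρ + 2 * n + 1)) := by ring
      rw [h1]
      exact mul_le_mul_of_nonneg_right hlow (by positivity)
    · have h1 : ‖w s‖ * (ρ * q ^ (t₀ ρ + 2 * (n + s))) =
          ‖w s‖ * q ^ (2 * s) * (ρ * q ^ t₀ ρ) * q ^ (2 * n) := by ring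
      have h2 : ‖w s‖ * q ^ (2 * s) * (ρ * q ^ t₀ ρ) ≤ 1 / 2 :=
        le_trans (mul_le_mul_of_nonneg_right hup (by positivity)) (ht₀' ρ)
      have h3 : q ^ (2 * n) ≤ 1 := pow_le_one₀ hq0.le hq1.le
      show ‖w s‖ * (ρ * q ^ (t₀ ρ + 2 * (n + s))) ≤ 1 / 2
      rw [h1]
      exact le_trans (mul_le_of_le_one_right (by positivity) h3) h2

theorem isClosed_unitCube (n : ℕ) : IsClosed (unitCube n) := by
  have h : unitCube n = ⋂ j, (fun a : EuclideanSpace ℝ (Fin n) => a j) ⁻¹' Set.Icc 0 1 := by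
    ext a
    simp only [unitCube, Set.mem_iInter, Set.mem_preimage, Set.mem_ofPred_eq]
  rw [h]
  exact isClosed_iInter fun j => isClosed_Icc.preimage (by fun_prop)

theorem theorem1 (n m : ℕ) (k : Fin n → ℝ) (hk : ∀ j, 0 < k j) (hsum : ∑ j, k j = 1)
    (L : Matrix (Fin n) (Fin m) ℝ) (hL : L ∈ Bad k m) :
    IsWinning (1 / 2) (periodicExt (twistedBad L k)) ∧
      IsWinning (1 / 2) ((Subtype.val : unitCube n → EuclideanSpace ℝ (Fin n)) ⁻¹'
        twistedBad L k) := by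
  have hm : 0 < m := by
    rcases Nat.eq_zero_or_pos m with rfl | h
    -- For m = 0 the infimum defining `Bad` is over an empty type, hence 0, so no matrix is bad.
    · have : IsEmpty {q : Fin 0 → ℤ // q ≠ 0} := ⟨fun q => q.2 (Subsingleton.elim _ _)⟩
      simp only [Bad, Set.mem_ofPred_eq, Real.iInf_of_isEmpty, lt_irrefl] at hL
    · exact h
  constructor
  · refine isWinning_of_mem_Bad hm hk hsum hL isometry_id (Or.inl Set.range_id)
      fun x ⟨c, hc, hx⟩ _ => ⟨fun j => ⟨Int.fract_nonneg _, Int.fract_lt_one _⟩,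
        iInf_iSup_pos_of_forall_exists hm
          (d := fun q j => distInt (linForm L q j - Int.fract (x j))) hc fun q hq => ?_⟩
    simpa only [distInt_sub_fract, id_eq] using hx q hq
  · have : CompleteSpace (unitCube n) := (isClosed_unitCube n).completeSpace_coe
    exact isWinning_of_mem_Bad hm hk hsum hL isometry_subtype_coe (Or.inr Subtype.range_coe)
      fun x ⟨c, hc, hx⟩ hlt => ⟨fun j => ⟨(x.2 j).1, hlt Subtype.range_coe j⟩,
        iInf_iSup_pos_of_forall_exists hm
          (d := fun q j => distInt (linForm L q j - x.1 j)) hc hx⟩
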